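/- Let $n\ge 0$, let $M$ be a smooth manifold of dimension $2n+1$, and let $\eta$ be a contact form on $M$, i.e. a smooth $1$-form such that $\eta\wedge(d\eta)^{\wedge n}$ vanishes nowhere. Let $\mathcal R$ be its Reeb vector field, defined by $\eta(\mathcal R)=1$ and $d\eta(\mathcal R,\cdot)=0$. For $f\in C^\infty(M)$ let $X_f$ be the contact Hamiltonian vector field of $f$, defined by $$\eta(X_f)=-f,\qquad d\eta(X_f,\cdot)=df-\mathcal R(f)\,\eta .$$ Let $\flat:TM\to T^*M$, $\flat v=\iota_v d\eta+\eta(v)\,\eta$, let $\Lambda(\sigma,\nu)=-d\eta(\flat^{-1}\sigma,\flat^{-1}\nu)$, and let $$\{f,g\}_\eta=\Lambda(df,dg)+g\,\mathcal R(f)-f\,\mathcal R(g)$$ be the Jacobi bracket. Let $(M,\eta,\{f_0,\dots,f_n\})$ be a complete contact integrable system, i.e. $f_0,\dots,f_n\in C^\infty(M)$ satisfy $\{f_i,f_j\}_\eta=0$ for all $i,j\in\{0,\dots,n\}$, and $X_{f_0},\dots,X_{f_n}$ are linearly independent almost everywhere. Write $\iota_{X_{f_0},\dots,X_{f_n}}\Omega=\Omega(X_{f_0},\dots,X_{f_n},\cdot,\dots,\cdot)$.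 Then, everywhere on $M$, $$\iota_{X_{f_0},X_{f_1},\dots,X_{f_n}}\bigl(\eta\wedge(d\eta)^{\wedge n}\bigr)=n!\,(-1)^{\frac12(n+1)(n+2)}\sum_{j=0}^{n}(-1)^{jn}\,f_j\,\bigwedge_{r=1}^{n}df_{(j+r)\bmod (n+1)} ,$$ where $\bigwedge_{r=1}^{n}$ is the wedge product in increasing order of $r$ (equal to $1$ if $n=0$). Wedge products are in the determinant normalization, $(\alpha\wedge\beta)(u,v)=\alpha(u)\beta(v)-\alpha(v)\beta(u)$ for $1$-forms, and $d\eta(U,V)=U(\eta(V))-V(\eta(U))-\eta([U,V])$. -/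

import Mathlib

open scoped Manifold ContDiff Bundle Nat

noncomputable section

namespace ContactGeom

/-! ### Exterior algebra of alternating forms on a real vector space -/

section Algebra

variable {V : Type*} [AddCommGroup V] [Module ℝ V]

/-- A linear form regarded as an alternating `1`-form. -/
def oneForm (α : V →ₗ[ℝ] ℝ) : V [⋀^Fin 1]→ₗ[ℝ] ℝ :=
  AlternatingMap.ofSubsingleton ℝ V ℝ 0 α

/-- The wedge product of alternating forms in the shuffle (determinant) normalization:
`(α ∧ β)(v₁, …, v_{k+l})` is the sum over `(k, l)`-shuffles `σ` of
`sign σ * α (v_{σ 1}, …, v_{σ k}) * β (v_{σ (k+1)}, …, v_{σ (k+l)})`. -/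
def wedge {k l : ℕ} (α : V [⋀^Fin k]→ₗ[ℝ] ℝ) (β : V [⋀^Fin l]→ₗ[ℝ] ℝ) :
    V [⋀^Fin (k + l)]→ₗ[ℝ] ℝ :=
  ((LinearMap.mul' ℝ ℝ).compAlternatingMap (α.domCoprod β)).domDomCongr finSumFinEquiv

/-- The power `τ ∧ … ∧ τ` (`m` factors) of a `2`-form, equal to the constant `1` for `m = 0`. -/
def wedgePow (τ : V [⋀^Fin 2]→ₗ[ℝ] ℝ) : (m : ℕ) → V [⋀^Fin (2 * m)]→ₗ[ℝ] ℝ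
  | 0 => AlternatingMap.constOfIsEmpty ℝ V (Fin 0) 1
  | m + 1 => wedge (wedgePow τ m) τ

/-- The ordered wedge product `α₀ ∧ α₁ ∧ … ∧ α_{m-1}` of linear forms, equal to the
constant `1` for `m = 0`. -/
def wedgeProd : (m : ℕ) → (Fin m → V →ₗ[ℝ] ℝ) → V [⋀^Fin m]→ₗ[ℝ] ℝ
  | 0, _ => AlternatingMap.constOfIsEmpty ℝ V (Fin 0) 1
  | m + 1, α => wedge (wedgeProd m fun r => α r.castSucc) (oneForm (α (Fin.last m)))

/-- The contraction `Ω(X₀, …, X_{m-1}, ·, …, ·)`: the vectors `X₀, …, X_{m-1}` are inserted, in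
this order, in the first `m` slots of `Ω`. -/
def contract {k : ℕ} : (m : ℕ) → V [⋀^Fin (k + m)]→ₗ[ℝ] ℝ → (Fin m → V) → V [⋀^Fin k]→ₗ[ℝ] ℝ
  | 0, Ω, _ => Ω
  | m + 1, Ω, X => contract m (AlternatingMap.curryLeft (n := k + m) Ω (X 0)) (fun i => X i.succ)

end Algebra

/-! ### Differential forms on a manifold, contact forms -/

section Manifold

variable {d : ℕ} {M : Type*} [TopologicalSpace M] [ChartedSpace (EuclideanSpace ℝ (Fin d)) M]

/-- The (pointwise) data of a differential `1`-form on `M`. -/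
abbrev OneForm (d : ℕ) (M : Type*) [TopologicalSpace M]
    [ChartedSpace (EuclideanSpace ℝ (Fin d)) M] : Type _ :=
  (x : M) → TangentSpace (𝓡 d) x →L[ℝ] ℝ

/-- A `1`-form is smooth when it is a smooth section of the cotangent bundle. -/
def IsSmooth [IsManifold (𝓡 d) ∞ M] (η : OneForm d M) : Prop :=
  ContMDiff (𝓡 d) ((𝓡 d).prod 𝓘(ℝ, EuclideanSpace ℝ (Fin d) →L[ℝ] ℝ)) ∞
    (fun x => Bundle.TotalSpace.mk' (EuclideanSpace ℝ (Fin d) →L[ℝ] ℝ)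
      (E := fun x : M => TangentSpace (𝓡 d) x →L[ℝ] Bundle.Trivial M ℝ x) x (η x))

/-- The coordinate expression of a `1`-form in the preferred chart at `p`, i.e. its pullback
under the inverse of this chart. -/
def inChart (η : OneForm d M) (p : M) :
    EuclideanSpace ℝ (Fin d) → EuclideanSpace ℝ (Fin d) [⋀^Fin 1]→L[ℝ] ℝ :=
  fun y => ContinuousAlternatingMap.ofSubsingleton ℝ (EuclideanSpace ℝ (Fin d)) ℝ 0
    ((η ((extChartAt (𝓡 d) p).symm y)).comp
      (mfderiv 𝓘(ℝ, EuclideanSpace ℝ (Fin d)) (𝓡 d) (extChartAt (𝓡 d) p).symm y))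

/-- The exterior derivative `dη` of a `1`-form at `x`: the pullback, under the chart at `x`, of
the exterior derivative of the coordinate expression of `η`. -/
def extD (η : OneForm d M) (x : M) : TangentSpace (𝓡 d) x [⋀^Fin 2]→ₗ[ℝ] ℝ :=
  ((extDeriv (inChart η x) (extChartAt (𝓡 d) x x)).compContinuousLinearMap
    (mfderiv (𝓡 d) 𝓘(ℝ, EuclideanSpace ℝ (Fin d)) (extChartAt (𝓡 d) x) x)).toAlternatingMap

/-- The `(2n+1)`-form `η ∧ (dη)^{∧ n}` at `x`. -/
def vol (n : ℕ) (η : OneForm d M) (x : M) :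
    TangentSpace (𝓡 d) x [⋀^Fin (1 + 2 * n)]→ₗ[ℝ] ℝ :=
  wedge (oneForm (η x).toLinearMap) (wedgePow (extD η x) n)

/-- `η` is a contact form on the `(2n+1)`-dimensional manifold `M`: it is smooth and
`η ∧ (dη)^{∧ n}` vanishes nowhere. -/
structure IsContactForm {n : ℕ} {M : Type*} [TopologicalSpace M]
    [ChartedSpace (EuclideanSpace ℝ (Fin (2 * n + 1))) M] [IsManifold (𝓡 (2 * n + 1)) ∞ M]
    (η : OneForm (2 * n + 1) M) : Prop where
  smooth : IsSmooth η
  nondegenerate : ∀ x, vol n η x ≠ 0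

/-- The Reeb vector field of `η`: at `x` it is the vector `R` with `η(R) = 1` and
`dη(R, ·) = 0` (which exists and is unique for a contact form). -/
def reeb (η : OneForm d M) (x : M) : TangentSpace (𝓡 d) x :=
  Classical.epsilon fun v : TangentSpace (𝓡 d) x =>
    η x v = 1 ∧ ∀ w : TangentSpace (𝓡 d) x, extD η x ![v, w] = 0

/-- The differential of a real function on `M`. -/
def df (f : M → ℝ) (x : M) : TangentSpace (𝓡 d) x →L[ℝ] ℝ :=
  mvfderiv (𝓡 d) f x

/-- The contact Hamiltonian vector field `X_f`: at `x` it is the vector `X` with `η(X) = -f` and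
`dη(X, ·) = df - R(f) η` (which exists and is unique for a contact form). -/
def hamVF (η : OneForm d M) (f : M → ℝ) (x : M) : TangentSpace (𝓡 d) x :=
  Classical.epsilon fun v : TangentSpace (𝓡 d) x =>
    η x v = -f x ∧ ∀ w : TangentSpace (𝓡 d) x,
      extD η x ![v, w] = df f x w - df f x (reeb η x) * η x w

/-- The bundle map `♭ : TM → T*M`, `♭ v = ι_v dη + η(v) η`. -/
def flat (η : OneForm d M) (x : M) (v : TangentSpace (𝓡 d) x) :
    TangentSpace (𝓡 d) x →ₗ[ℝ] ℝ :=
  (AlternatingMap.ofSubsingleton ℝ (TangentSpace (𝓡 d) x) ℝ (0 : Fin 1)).symm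
      (AlternatingMap.curryLeft (n := 1) (extD η x) v)
    + η x v • (η x).toLinearMap

/-- The inverse `♭⁻¹ : T*M → TM` (for a contact form, `♭` is bijective at every point). -/
def sharp (η : OneForm d M) (x : M) : (TangentSpace (𝓡 d) x →ₗ[ℝ] ℝ) → TangentSpace (𝓡 d) x :=
  Function.invFun (flat η x)

/-- The bivector `Λ(σ, ν) = -dη(♭⁻¹ σ, ♭⁻¹ ν)`. -/
def bivector (η : OneForm d M) (x : M) (σ ν : TangentSpace (𝓡 d) x →ₗ[ℝ] ℝ) : ℝ :=
  -(extD η x) ![sharp η x σ, sharp η x ν]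

/-- The Jacobi bracket `{f, g}_η = Λ(df, dg) - g E(f) + f E(g)` of the Jacobi structure `(Λ, E)`
of a contact form, where `E = -R` is minus the Reeb vector field. -/
def jacobiBracket (η : OneForm d M) (f g : M → ℝ) (x : M) : ℝ :=
  bivector η x (df f x).toLinearMap (df g x).toLinearMap
    - g x * df f x (-reeb η x) + f x * df g x (-reeb η x)

/-- A subset of `M` is null when its image in every preferred chart has Lebesgue measure zero. -/
def IsNull (d : ℕ) {M : Type*} [TopologicalSpace M]
    [ChartedSpace (EuclideanSpace ℝ (Fin d)) M] (S : Set M) : Prop :=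
  ∀ p : M, MeasureTheory.volume
    (extChartAt (𝓡 d) p '' (S ∩ (extChartAt (𝓡 d) p).source)) = 0

/-- A complete contact integrable system `(M, η, {f₀, …, f_n})` on a `(2n+1)`-dimensional
manifold: `η` is a contact form, and the smooth functions `f₀, …, f_n` are pairwise in involution
for the Jacobi bracket and have contact Hamiltonian vector fields that are linearly independent
almost everywhere. -/
structure IsCompleteContactIntegrable {n : ℕ} {M : Type*} [TopologicalSpace M]
    [ChartedSpace (EuclideanSpace ℝ (Fin (2 * n + 1))) M] [IsManifold (𝓡 (2 * n + 1)) ∞ M]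
    (η : OneForm (2 * n + 1) M) (f : Fin (n + 1) → M → ℝ) : Prop where
  contact : IsContactForm η
  smooth : ∀ i, ContMDiff (𝓡 (2 * n + 1)) 𝓘(ℝ, ℝ) ∞ (f i)
  involution : ∀ i j x, jacobiBracket η (f i) (f j) x = 0
  independent : IsNull (2 * n + 1) {x : M | ¬ LinearIndependent ℝ fun i => hamVF η (f i) x}

end Manifold

end ContactGeom

end

/-! The identity is linear algebra at each point. Write `η` and `τ = dη` for the forms there, `X i`
for the Hamiltonian vectors, `α i = df_i`, `r i = R(f_i)`. Involution says `τ(X i, X j) = f j * r i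
- f i * r j`. If some `f k ≠ 0`, then `b = -α k / f k` satisfies `b (X j) = r j`, so `τ' = τ - η ∧
b` vanishes on all pairs of `X`'s, while `η ∧ τ^n = η ∧ τ'^n`.

In the contraction with `n + 1` vectors `X` and `n` arguments `w`, each `τ'` must then take one `X`
and one `w`, and `η` takes the remaining `X`. Up to the sign of an unshuffle, this is `n!` times the
determinant with first column `η (X i) = -f i` and other entries `τ'(X i, w l) = α i (w l) + f i * b
(w l)`. A column operation removes `b`, and Laplace expansion along the first column, with rows kept
in cyclic order, gives the sum. If all `f k` vanish, both sides are zero.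

`sum_sign_mul_prod_antisymm` replaces `τ` by `τ'`, `contract_wedge_oneForm_wedgePow` computes the
determinant, `det_eq_sum_cyclic` expands it, and `contract_eq_of_involution` combines them. -/

noncomputable section

namespace ContactGeom

/-! ### Wedge products as full signed sums over permutations. -/

section Alternatization

variable {V : Type*} [AddCommGroup V] [Module ℝ V]

/-- `α` is the alternatization of a multilinear map with underlying function `F`. -/
def IsAlternatizationOf {k : ℕ} (α : V [⋀^Fin k]→ₗ[ℝ] ℝ) (F : (Fin k → V) → ℝ) : Prop :=
  ∃ A : MultilinearMap ℝ (fun _ : Fin k => V) ℝ,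
    MultilinearMap.alternatization A = α ∧ ∀ v, A v = F v

theorem IsAlternatizationOf.apply {k : ℕ} {α : V [⋀^Fin k]→ₗ[ℝ] ℝ} {F : (Fin k → V) → ℝ}
    (h : IsAlternatizationOf α F) (v : Fin k → V) :
    α v = ∑ σ : Equiv.Perm (Fin k), ((Equiv.Perm.sign σ : ℤ) : ℝ) * F (v ∘ σ) := by
  obtain ⟨A, rfl, hF⟩ := h
  rw [MultilinearMap.alternatization_apply]
  refine Finset.sum_congr rfl fun σ _ => ?_
  rw [MultilinearMap.domDomCongr_apply, hF, Units.smul_def, zsmul_eq_mul]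
  rfl

/-- In the shuffle normalization no factorials appear: a permutation is a shuffle composed with
permutations inside the two blocks. -/
theorem IsAlternatizationOf.wedge {k l : ℕ} {α : V [⋀^Fin k]→ₗ[ℝ] ℝ} {β : V [⋀^Fin l]→ₗ[ℝ] ℝ}
    {F : (Fin k → V) → ℝ} {G : (Fin l → V) → ℝ}
    (hα : IsAlternatizationOf α F) (hβ : IsAlternatizationOf β G) :
    IsAlternatizationOf (wedge α β)
      (fun v => F (v ∘ Fin.castAdd l) * G (v ∘ Fin.natAdd k)) := by
  obtain ⟨A, rfl, hF⟩ := hα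
  obtain ⟨B, rfl, hG⟩ := hβ
  refine ⟨((LinearMap.mul' ℝ ℝ).compMultilinearMap (A.domCoprod B)).domDomCongr finSumFinEquiv,
    ?_, fun v => ?_⟩
  · rw [ContactGeom.wedge, ← MultilinearMap.domCoprod_alternization,
      ← LinearMap.compMultilinearMap_alternatization]
    ext v
    simp only [MultilinearMap.alternatization_apply, AlternatingMap.domDomCongr_apply,
      MultilinearMap.domDomCongr_apply]
    refine Fintype.sum_equiv finSumFinEquiv.permCongr.symm _ _ fun σ => ?_
    rw [Equiv.permCongr_symm, Equiv.Perm.sign_permCongr]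
    simp [Equiv.permCongr_apply]
  · simp [← hF, ← hG]
    rfl

theorem isAlternatizationOf_oneForm (α : V →ₗ[ℝ] ℝ) :
    IsAlternatizationOf (oneForm α) (fun v => α (v 0)) := by
  refine ⟨MultilinearMap.ofSubsingleton ℝ V ℝ (0 : Fin 1) α, ?_, fun v => rfl⟩
  ext v
  rw [MultilinearMap.alternatization_apply]
  simp [oneForm]

/-- Alternatizing a form that is already alternating multiplies it by `2!`. -/
theorem isAlternatizationOf_two (τ : V [⋀^Fin 2]→ₗ[ℝ] ℝ) :
    IsAlternatizationOf τ (fun v => τ ![v 0, v 1] / 2) := by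
  refine ⟨(1 / 2 : ℝ) • τ.toMultilinearMap, ?_, fun v => ?_⟩
  · ext v
    have := congrArg (fun α => α v) (AlternatingMap.coe_alternatization τ)
    simp only [MultilinearMap.alternatization_apply, MultilinearMap.domDomCongr_apply] at this ⊢
    simp only [smul_apply, smul_comm _ (1 / 2 : ℝ)]
    rw [← Finset.smul_sum]
    refine (congrArg _ this).trans ?_
    simp
  · have : ![v 0, v 1] = v := by ext i; fin_cases i <;> rfl
    simp only [this, smul_apply, smul_eq_mul, AlternatingMap.coe_multilinearMap]
    ring

theorem isAlternatizationOf_wedgePow (τ : V [⋀^Fin 2]→ₗ[ℝ] ℝ) (m : ℕ) :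
    IsAlternatizationOf (wedgePow τ m) (fun v => ∏ i : Fin m,
      τ ![v ⟨2 * i, by omega⟩, v ⟨2 * i + 1, by omega⟩] / 2) := by
  induction m with
  | zero =>
    have : IsEmpty (Fin (2 * 0)) := inferInstanceAs (IsEmpty (Fin 0))
    refine ⟨MultilinearMap.constOfIsEmpty ℝ _ 1, ?_, fun v => by simp⟩
    ext v
    rw [MultilinearMap.alternatization_apply, Fintype.sum_unique]
    simp [wedgePow]
  | succ m ih =>
    have := ih.wedge (isAlternatizationOf_two τ)
    simp only [Fin.prod_univ_castSucc]
    exact this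

theorem isAlternatizationOf_wedgeProd (m : ℕ) (α : Fin m → V →ₗ[ℝ] ℝ) :
    IsAlternatizationOf (wedgeProd m α) (fun v => ∏ i, α i (v i)) := by
  induction m with
  | zero =>
    refine ⟨MultilinearMap.constOfIsEmpty ℝ _ 1, ?_, fun v => by simp⟩
    ext v
    rw [MultilinearMap.alternatization_apply]
    simp [wedgeProd]
  | succ m ih =>
    have := (ih fun r => α r.castSucc).wedge (isAlternatizationOf_oneForm (α (Fin.last m)))
    simp only [Fin.prod_univ_castSucc]
    exact this

theorem isAlternatizationOf_wedge_oneForm_wedgePow (η : V →ₗ[ℝ] ℝ) (τ : V [⋀^Fin 2]→ₗ[ℝ] ℝ)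
    (n : ℕ) :
    IsAlternatizationOf (wedge (oneForm η) (wedgePow τ n)) (fun v => η (v ⟨0, by omega⟩) *
      ∏ i : Fin n, τ ![v ⟨2 * i + 1, by omega⟩, v ⟨2 * i + 2, by omega⟩] / 2) := by
  have := (isAlternatizationOf_oneForm η).wedge (isAlternatizationOf_wedgePow τ n)
  simp only [Function.comp, Fin.natAdd_mk, Nat.add_comm 1] at this
  exact this

theorem wedgeProd_apply_eq_det (m : ℕ) (α : Fin m → V →ₗ[ℝ] ℝ) (v : Fin m → V) :
    wedgeProd m α v = Matrix.det (Matrix.of fun i l => α i (v l)) := by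
  rw [(isAlternatizationOf_wedgeProd m α).apply, ← Matrix.det_transpose, Matrix.det_apply']
  rfl

theorem contract_apply {k : ℕ} (m : ℕ) (Ω : V [⋀^Fin (k + m)]→ₗ[ℝ] ℝ) (X : Fin m → V)
    (w : Fin k → V) :
    contract m Ω X w = Ω (Fin.append X w ∘ Fin.cast (Nat.add_comm k m)) := by
  induction m with
  | zero =>
    simp only [contract]
    congr 1
    ext i
    simp [Fin.append, Fin.addCases]
  | succ m ih =>
    rw [contract, ih]
    rw [AlternatingMap.curryLeft_apply_apply]
    congr 1
    ext i
    refine Fin.cases ?_ (fun i => ?_) i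
    · rfl
    · simp only [Matrix.cons_val_succ, Function.comp, Fin.append, Fin.addCases]
      by_cases hi : (i : ℕ) < m
      · refine (dif_pos hi).trans ((dif_pos (Nat.succ_lt_succ hi)).trans ?_).symm
        rfl
      · refine (dif_neg hi).trans
          ((dif_neg fun h => hi (Nat.lt_of_succ_lt_succ h)).trans ?_).symm
        simp only [eq_rec_constant]
        congr 1
        ext
        simp

end Alternatization

/-! ### Cancellation in signed sums over permutations. -/

section SignedSums

open Equiv.Perm

variable {J : Type*} [Fintype J] [DecidableEq J]

theorem sum_sign_mul_eq_neg_comp_swap (G : Equiv.Perm J → ℝ) {p q : J} (hpq : p ≠ q) :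
    ∑ σ, ((sign σ : ℤ) : ℝ) * G (σ * Equiv.swap p q) = -∑ σ, ((sign σ : ℤ) : ℝ) * G σ := by
  rw [← Finset.sum_neg_distrib]
  refine Fintype.sum_equiv (Equiv.mulRight (Equiv.swap p q)) _ _ fun σ => ?_
  simp [sign_swap hpq]

theorem sum_sign_mul_eq_zero (G : Equiv.Perm J → ℝ) {p q : J} (hpq : p ≠ q)
    (hG : ∀ σ, G (σ * Equiv.swap p q) = G σ) : ∑ σ, ((sign σ : ℤ) : ℝ) * G σ = 0 := by
  have := sum_sign_mul_eq_neg_comp_swap G hpq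
  simp only [hG] at this
  linarith

/-- In a signed sum over permutations of a product `h ∏ a` with `a = t - tᵀ + h ⊗ b - b ⊗ h`, each
factor `a` can be replaced by `2 t`. -/
theorem sum_sign_mul_prod_antisymm {ι : Type*} [Fintype ι] [DecidableEq ι]
    (o : J) (p q : ι → J) (hop : ∀ i, o ≠ p i) (hoq : ∀ i, o ≠ q i)
    (hp : Function.Injective p) (hq : Function.Injective q) (hpq : ∀ i j, p i ≠ q j)
    (h b : J → ℝ) (a t : J → J → ℝ)
    (hat : ∀ r s, a r s = t r s - t s r + h r * b s - b r * h s) :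
    ∑ σ : Equiv.Perm J, ((sign σ : ℤ) : ℝ) * (h (σ o) * ∏ i, a (σ (p i)) (σ (q i))) =
      2 ^ Fintype.card ι *
        ∑ σ : Equiv.Perm J, ((sign σ : ℤ) : ℝ) * (h (σ o) * ∏ i, t (σ (p i)) (σ (q i))) := by
  have key : ∀ S : Finset ι,
      ∑ σ : Equiv.Perm J, ((sign σ : ℤ) : ℝ) * (h (σ o) * ∏ i, a (σ (p i)) (σ (q i))) =
      2 ^ S.card * ∑ σ : Equiv.Perm J, ((sign σ : ℤ) : ℝ) * (h (σ o) *
        ((∏ i ∈ S, t (σ (p i)) (σ (q i))) * ∏ i ∈ Sᶜ, a (σ (p i)) (σ (q i)))) := by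
    intro S
    -- The factors indexed by `S` have been replaced; each replacement contributes a factor 2.
    induction S using Finset.induction_on with
    | empty => simp
    | insert i S hi ih =>
      rw [ih, Finset.card_insert_of_notMem hi, pow_succ, mul_assoc]
      congr 1
      have hc : i ∈ Sᶜ := by simpa using hi
      have hS : (insert i S)ᶜ = Sᶜ.erase i := by
        ext j; simp
      set R : Equiv.Perm J → ℝ := fun σ =>
        (∏ i ∈ S, t (σ (p i)) (σ (q i))) * ∏ j ∈ Sᶜ.erase i, a (σ (p j)) (σ (q j)) with hR
      have hRinv : ∀ x y, (∀ j, j ≠ i → x ≠ p j ∧ x ≠ q j ∧ y ≠ p j ∧ y ≠ q j) →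
          ∀ σ, R (σ * Equiv.swap x y) = R σ := by
        intro x y hxy σ
        simp only [hR]
        congr 1
        · refine Finset.prod_congr rfl fun j hj => ?_
          obtain ⟨h1, h2, h3, h4⟩ := hxy j (fun e => hi (e ▸ hj))
          simp [Equiv.swap_apply_of_ne_of_ne h1.symm h3.symm,
            Equiv.swap_apply_of_ne_of_ne h2.symm h4.symm]
        · refine Finset.prod_congr rfl fun j hj => ?_
          obtain ⟨h1, h2, h3, h4⟩ := hxy j (Finset.ne_of_mem_erase hj)
          simp [Equiv.swap_apply_of_ne_of_ne h1.symm h3.symm,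
            Equiv.swap_apply_of_ne_of_ne h2.symm h4.symm]
      have hpp : ∀ j, j ≠ i → p i ≠ p j := fun j hj e => hj (hp e).symm
      have hqq : ∀ j, j ≠ i → q i ≠ q j := fun j hj e => hj (hq e).symm
      -- The `h ⊗ b` and `b ⊗ h` terms die because they contain `h` twice: exchanging its two slots
      -- fixes the summand and flips the sign. This is `η ∧ η = 0`.
      have e1 : ∑ σ : Equiv.Perm J, ((sign σ : ℤ) : ℝ) *
          (h (σ o) * h (σ (p i)) * b (σ (q i)) * R σ) = 0 := by
        refine sum_sign_mul_eq_zero _ (hop i) fun σ => ?_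
        rw [hRinv _ _ (fun j hj => ⟨hop j, hoq j, hpp j hj, hpq i j⟩)]
        simp only [coe_mul, Function.comp, Equiv.swap_apply_left, Equiv.swap_apply_right,
          Equiv.swap_apply_of_ne_of_ne (hoq i).symm (hpq i i).symm]
        ring
      have e2 : ∑ σ : Equiv.Perm J, ((sign σ : ℤ) : ℝ) *
          (h (σ o) * b (σ (p i)) * h (σ (q i)) * R σ) = 0 := by
        refine sum_sign_mul_eq_zero _ (hoq i) fun σ => ?_
        rw [hRinv _ _ (fun j hj => ⟨hop j, hoq j, (hpq j i).symm, hqq j hj⟩)]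
        simp only [coe_mul, Function.comp, Equiv.swap_apply_left, Equiv.swap_apply_right,
          Equiv.swap_apply_of_ne_of_ne (hop i).symm (hpq i i)]
        ring
      -- Exchanging the two slots of the factor turns the `-tᵀ` term into a second copy of the `t`
      -- term.
      have e3 := sum_sign_mul_eq_neg_comp_swap
        (fun σ => h (σ o) * t (σ (p i)) (σ (q i)) * R σ) (hpq i i)
      simp only [hRinv (p i) (q i) (fun j hj => ⟨hpp j hj, hpq i j, (hpq j i).symm, hqq j hj⟩)]
        at e3
      simp only [coe_mul, Function.comp, Equiv.swap_apply_left, Equiv.swap_apply_right,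
        Equiv.swap_apply_of_ne_of_ne (hop i) (hoq i)] at e3
      have e4 : ∀ σ : Equiv.Perm J, ((sign σ : ℤ) : ℝ) * (h (σ o) *
          ((∏ i ∈ S, t (σ (p i)) (σ (q i))) * ∏ i ∈ Sᶜ, a (σ (p i)) (σ (q i)))) =
          ((sign σ : ℤ) : ℝ) * (h (σ o) * t (σ (p i)) (σ (q i)) * R σ)
          - ((sign σ : ℤ) : ℝ) * (h (σ o) * t (σ (q i)) (σ (p i)) * R σ)
          + ((sign σ : ℤ) : ℝ) * (h (σ o) * h (σ (p i)) * b (σ (q i)) * R σ)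
          - ((sign σ : ℤ) : ℝ) * (h (σ o) * b (σ (p i)) * h (σ (q i)) * R σ) := by
        intro σ
        rw [← Finset.mul_prod_erase _ _ hc, hat]
        simp only [hR]
        ring
      have e5 : ∀ σ : Equiv.Perm J, ((sign σ : ℤ) : ℝ) * (h (σ o) *
          ((∏ i ∈ insert i S, t (σ (p i)) (σ (q i))) *
            ∏ i ∈ (insert i S)ᶜ, a (σ (p i)) (σ (q i)))) =
          ((sign σ : ℤ) : ℝ) * (h (σ o) * t (σ (p i)) (σ (q i)) * R σ) := by
        intro σ
        rw [hS, Finset.prod_insert hi]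
        simp only [hR]
        ring
      simp only [e4, e5, Finset.sum_sub_distrib, Finset.sum_add_distrib, e1, e2, e3]
      ring
  have := key Finset.univ
  simpa using this

/-- A signed sum over the permutations of a sum type only sees the block permutations when the
summand vanishes on all others. -/
theorem sum_sign_mul_sum_type {A B : Type*} [Fintype A] [DecidableEq A] [Fintype B]
    [DecidableEq B] (G : Equiv.Perm (A ⊕ B) → ℝ)
    (hG : ∀ σ, (∃ b a, σ (Sum.inr b) = Sum.inl a) → G σ = 0) :
    ∑ σ, ((sign σ : ℤ) : ℝ) * G σ = ∑ ρ : Equiv.Perm A, ∑ κ : Equiv.Perm B,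
      ((sign ρ : ℤ) : ℝ) * ((sign κ : ℤ) : ℝ) * G (Equiv.sumCongr ρ κ) := by
  rw [← Fintype.sum_prod_type']
  symm
  refine Finset.sum_of_injOn (sumCongrHom A B) (sumCongrHom_injective.injOn) (by simp) ?_ ?_
  · intro σ _ hσ
    rw [hG σ, mul_zero]
    by_contra! hne
    apply hσ
    have hm : Set.MapsTo σ (Set.range Sum.inr) (Set.range Sum.inr) := by
      rintro _ ⟨b, rfl⟩
      rcases hx : σ (Sum.inr b) with a | c
      · exact absurd hx (hne b a)
      · exact ⟨c, rfl⟩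
    -- An injective self-map of the finite block `B` is onto, so `σ` must also preserve the block
    -- `A`.
    have hinr : ∀ b, ∃ c, σ (Sum.inr c) = Sum.inr b := by
      choose g hg using fun b => hm ⟨b, rfl⟩
      have hgi : Function.Injective g := fun x y e => by
        have := (hg x).symm.trans ((congrArg Sum.inr e).trans (hg y))
        simpa using this
      intro b
      obtain ⟨c, rfl⟩ := Finite.surjective_of_injective hgi b
      exact ⟨c, (hg c).symm⟩
    have hl : Set.MapsTo σ (Set.range Sum.inl) (Set.range Sum.inl) := by
      rintro _ ⟨a, rfl⟩
      rcases hx : σ (Sum.inl a) with c | b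
      · exact ⟨c, rfl⟩
      · obtain ⟨c, hc⟩ := hinr b
        simpa using σ.injective (hx.trans hc.symm)
    obtain ⟨x, hx⟩ := mem_sumCongrHom_range_of_perm_mapsTo_inl hl
    exact ⟨x, by simp, hx⟩
  · rintro ⟨ρ, κ⟩ _
    simp [sumCongrHom, sign_sumCongr]

/-- The sum is a determinant whose columns are permuted by `κ`, extended to fix column 0. -/
theorem sum_sign_mul_prod_eq_det {n : ℕ} (h : Fin (n + 1) → ℝ) (t : Fin (n + 1) → Fin n → ℝ)
    (κ : Equiv.Perm (Fin n)) :
    ∑ ρ : Equiv.Perm (Fin (n + 1)), ((sign ρ : ℤ) : ℝ) *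
        (h (ρ 0) * ∏ i : Fin n, t (ρ i.succ) (κ i)) =
      ((sign κ : ℤ) : ℝ) * Matrix.det (Matrix.of fun i => Fin.cons (h i) (t i) :
        Matrix (Fin (n + 1)) (Fin (n + 1)) ℝ) := by
  have := Matrix.det_permute' (decomposeFin.symm (0, κ)) (Matrix.of fun i => Fin.cons (h i) (t i) :
        Matrix (Fin (n + 1)) (Fin (n + 1)) ℝ)
  rw [decomposeFin.symm_sign, if_pos rfl, one_mul] at this
  rw [← this, Matrix.det_apply']
  refine Finset.sum_congr rfl fun ρ _ => ?_
  rw [Fin.prod_univ_succ]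
  simp [decomposeFin]

theorem sum_sign_mul_prod_blocks {n : ℕ} (h b : Fin (n + 1) ⊕ Fin n → ℝ)
    (a : Fin (n + 1) ⊕ Fin n → Fin (n + 1) ⊕ Fin n → ℝ) (ha : ∀ r s, a r s = -a s r)
    (hiso : ∀ i j, a (Sum.inl i) (Sum.inl j) =
      h (Sum.inl i) * b (Sum.inl j) - b (Sum.inl i) * h (Sum.inl j)) :
    ∑ σ : Equiv.Perm (Fin (n + 1) ⊕ Fin n), ((sign σ : ℤ) : ℝ) * (h (σ (Sum.inl 0)) *
        ∏ i : Fin n, a (σ (Sum.inl i.succ)) (σ (Sum.inr i))) =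
      2 ^ n * n ! * Matrix.det (Matrix.of fun i => Fin.cons (h (Sum.inl i)) fun l =>
        a (Sum.inl i) (Sum.inr l) - h (Sum.inl i) * b (Sum.inr l) + b (Sum.inl i) * h (Sum.inr l) :
        Matrix (Fin (n + 1)) (Fin (n + 1)) ℝ) := by
  -- `t - tᵀ` is `a` corrected by `h ∧ b`. The correction vanishes on pairs of `inl` indices, so `t`
  -- may be zero whenever its second index is `inl`; this leaves only block permutations. On pairs
  -- of `inr` indices the correction is split evenly.
  let t : Fin (n + 1) ⊕ Fin n → Fin (n + 1) ⊕ Fin n → ℝ := fun r s =>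
    match r, s with
    | _, Sum.inl _ => 0
    | Sum.inl i, Sum.inr l =>
      a (Sum.inl i) (Sum.inr l) - h (Sum.inl i) * b (Sum.inr l) + b (Sum.inl i) * h (Sum.inr l)
    | Sum.inr m, Sum.inr l =>
      (a (Sum.inr m) (Sum.inr l) - h (Sum.inr m) * b (Sum.inr l)
        + b (Sum.inr m) * h (Sum.inr l)) / 2
  have hat : ∀ r s, a r s = t r s - t s r + h r * b s - b r * h s := by
    rintro (i | i) (j | j)
    · simp [t, hiso]
    · simp only [t]; ring
    · simp only [t]; rw [ha]; ring
    · simp only [t]; rw [ha (Sum.inr j)]; ring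
  rw [sum_sign_mul_prod_antisymm (Sum.inl 0) (fun i : Fin n => Sum.inl i.succ) Sum.inr
    (fun i e => Fin.succ_ne_zero i (Sum.inl_injective e).symm) (by simp)
    (fun i j e => Fin.succ_injective _ (Sum.inl_injective e)) Sum.inr_injective (by simp)
    h b a t hat, Fintype.card_fin, mul_assoc]
  congr 1
  rw [sum_sign_mul_sum_type, Finset.sum_comm]
  -- The sign of `κ` occurs twice and cancels, so all `n!` choices of `κ` contribute the same
  -- determinant.
  · have : ∀ κ : Equiv.Perm (Fin n), ∑ ρ : Equiv.Perm (Fin (n + 1)),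
        ((sign ρ : ℤ) : ℝ) * ((sign κ : ℤ) : ℝ) * (h (Equiv.sumCongr ρ κ (Sum.inl 0)) *
          ∏ i : Fin n, t (Equiv.sumCongr ρ κ (Sum.inl i.succ)) (Equiv.sumCongr ρ κ (Sum.inr i))) =
        Matrix.det (Matrix.of fun i => Fin.cons (h (Sum.inl i)) fun l =>
          t (Sum.inl i) (Sum.inr l) : Matrix (Fin (n + 1)) (Fin (n + 1)) ℝ) := by
      intro κ
      have := sum_sign_mul_prod_eq_det (fun i => h (Sum.inl i))
        (fun i l => t (Sum.inl i) (Sum.inr l)) κ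
      have hs : ((sign κ : ℤ) : ℝ) * ((sign κ : ℤ) : ℝ) = 1 := by
        rcases Int.units_eq_one_or (sign κ) with e | e <;> simp [e]
      calc _ = ((sign κ : ℤ) : ℝ) * ∑ ρ : Equiv.Perm (Fin (n + 1)), ((sign ρ : ℤ) : ℝ) *
            (h (Sum.inl (ρ 0)) * ∏ i : Fin n, t (Sum.inl (ρ i.succ)) (Sum.inr (κ i))) := by
            rw [Finset.mul_sum]
            refine Finset.sum_congr rfl fun ρ _ => ?_
            simp only [Equiv.sumCongr_apply, Sum.map_inl, Sum.map_inr]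
            ring
        _ = _ := by rw [this, ← mul_assoc, hs, one_mul]
    rw [Finset.sum_congr rfl fun κ _ => this κ, Finset.sum_const, Finset.card_univ,
      Fintype.card_perm, Fintype.card_fin, nsmul_eq_mul]
  · rintro σ ⟨i, j, hij⟩
    rw [Finset.prod_eq_zero (Finset.mem_univ i), mul_zero]
    rw [hij]

end SignedSums

/-! ### The sign of the unshuffle. -/

section Shuffle

open Equiv.Perm

/-- The slots of a `1`-form and `n` two-forms: `inl 0` is the slot of the `1`-form, and
`inl i.succ`, `inr i` are the slots of the `i`-th two-form. -/
def slotEquiv (n : ℕ) : Fin (n + 1) ⊕ Fin n ≃ Fin (1 + 2 * n) :=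
  Equiv.ofBijective
    -- Truncated subtraction sends `inl 0` to slot 0.
    (Sum.elim (fun i => ⟨2 * i - 1, by omega⟩) (fun i => ⟨2 * i + 2, by omega⟩)) <| by
    rw [Fintype.bijective_iff_injective_and_card]
    refine ⟨?_, by simp; omega⟩
    rintro (i | i) (j | j) h <;> simp only [Sum.elim_inl, Sum.elim_inr, Fin.mk.injEq] at h
    · exact congrArg _ (Fin.ext (by omega))
    · omega
    · omega
    · exact congrArg _ (Fin.ext (by omega))

/-- The enumeration of the blocks one after the other. -/
def blockEquiv (n : ℕ) : Fin (n + 1) ⊕ Fin n ≃ Fin (1 + 2 * n) :=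
  finSumFinEquiv.trans (finCongr (by omega))

/-- The values of the permutation of `0, …, 2n` that takes `0, 1, 3, …, 2n-1, 2, 4, …, 2n` to
`0, 1, …, 2n`. -/
def unshuffle (n k : ℕ) : ℕ :=
  if k = 0 then 0 else if k % 2 = 1 then (k + 1) / 2 else n + k / 2

theorem unshuffle_zero (n : ℕ) : unshuffle n 0 = 0 := rfl

theorem unshuffle_odd (n m : ℕ) : unshuffle n (2 * m + 1) = m + 1 := by
  rw [unshuffle, if_neg (by omega), if_pos (by omega)]
  omega

theorem unshuffle_even (n m : ℕ) : unshuffle n (2 * m + 2) = n + m + 1 := by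
  rw [unshuffle, if_neg (by omega), if_neg (by omega)]
  omega

theorem slotEquiv_symm_trans_blockEquiv_apply (n : ℕ) (k : Fin (1 + 2 * n)) :
    (((slotEquiv n).symm.trans (blockEquiv n) k : Fin (1 + 2 * n)) : ℕ) = unshuffle n k := by
  obtain ⟨x, rfl⟩ := (slotEquiv n).surjective k
  rw [Equiv.trans_apply, Equiv.symm_apply_apply]
  rcases x with i | i
  · refine Fin.cases rfl (fun i => ?_) i
    have h : ((slotEquiv n (Sum.inl i.succ) : Fin (1 + 2 * n)) : ℕ) = 2 * i + 1 := by
      simp only [slotEquiv, Equiv.ofBijective_apply, Sum.elim_inl, Fin.val_succ]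
      omega
    rw [h, unshuffle_odd]
    simp [blockEquiv]
  · have h : ((slotEquiv n (Sum.inr i) : Fin (1 + 2 * n)) : ℕ) = 2 * i + 2 := rfl
    rw [h, unshuffle_even]
    simp only [blockEquiv, Equiv.trans_apply, finSumFinEquiv_apply_right, finCongr_apply,
      Fin.val_cast, Fin.val_natAdd]
    omega

theorem prod_range_odd {R : Type*} [CommMonoid R] (g : ℕ → R) (k : ℕ) :
    ∏ i ∈ Finset.range (1 + 2 * k), g i =
      g 0 * ∏ m ∈ Finset.range k, (g (2 * m + 1) * g (2 * m + 2)) := by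
  induction k with
  | zero => simp
  | succ k ih =>
    rw [Finset.prod_range_succ _ k, ← mul_assoc, ← ih,
      show 1 + 2 * (k + 1) = 1 + 2 * k + 1 + 1 by ring, Finset.prod_range_succ,
      Finset.prod_range_succ, mul_assoc]
    congr 3 <;> ring

theorem sign_slotEquiv_symm_trans_blockEquiv (n : ℕ) :
    ((sign ((slotEquiv n).symm.trans (blockEquiv n)) : ℤ) : ℝ) = (-1) ^ (n * (n - 1) / 2) := by
  have h1 : sign ((slotEquiv n).symm.trans (blockEquiv n)) =
      ∏ j ∈ Finset.range (1 + 2 * n), ∏ i ∈ Finset.range j,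
        if unshuffle n i < unshuffle n j then (1 : ℤˣ) else -1 := by
    rw [sign_eq_prod_prod_Iio, ← Fin.prod_univ_eq_prod_range
      (fun j => ∏ i ∈ Finset.range j, if unshuffle n i < unshuffle n j then (1 : ℤˣ) else -1)]
    refine Finset.prod_congr rfl fun j _ => ?_
    refine Finset.prod_nbij (fun i => (i : ℕ)) (by simp) (Fin.val_injective.injOn) ?_ ?_
    · intro i hi
      have hi : i < (j : ℕ) := by simpa using hi
      exact ⟨⟨i, by omega⟩, by simpa [Fin.lt_def] using hi, rfl⟩
    · intro i _
      simp only [Fin.lt_def, slotEquiv_symm_trans_blockEquiv_apply]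
  -- Position `2k + 1` is inverted exactly with the earlier positions `2, 4, …, 2k`, and position
  -- `2k + 2` with none, so the inversions number `0 + 1 + … + (n - 1)`.
  have h2 : ∀ k ∈ Finset.range n, (∏ i ∈ Finset.range (2 * k + 1),
      (if unshuffle n i < unshuffle n (2 * k + 1) then (1 : ℤˣ) else -1)) *
      (∏ i ∈ Finset.range (2 * k + 2),
        (if unshuffle n i < unshuffle n (2 * k + 2) then (1 : ℤˣ) else -1)) = (-1) ^ k := by
    intro k hk
    have hk := Finset.mem_range.1 hk
    rw [Finset.prod_eq_one (s := Finset.range (2 * k + 2)), mul_one, Nat.add_comm (2 * k) 1,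
      prod_range_odd, if_pos, one_mul]
    · rw [Finset.prod_congr rfl (g := fun _ => -1), Finset.prod_const, Finset.card_range]
      intro m hm
      have hm := Finset.mem_range.1 hm
      rw [Nat.add_comm 1 (2 * k), unshuffle_odd, unshuffle_odd, unshuffle_even,
        if_pos (by omega), if_neg (by omega), one_mul]
    · rw [Nat.add_comm 1 (2 * k), unshuffle_odd, unshuffle_zero]
      omega
    · intro i hi
      have hi := Finset.mem_range.1 hi
      rw [if_pos]
      rw [unshuffle_even]
      obtain rfl | ⟨m, rfl⟩ | ⟨m, rfl⟩ : i = 0 ∨ (∃ m, i = 2 * m + 1) ∨ ∃ m, i = 2 * m + 2 := by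
        rcases Nat.even_or_odd' i with ⟨m, rfl | rfl⟩
        · rcases m with _ | m
          · simp
          · exact Or.inr (Or.inr ⟨m, by ring⟩)
        · exact Or.inr (Or.inl ⟨m, rfl⟩)
      · rw [unshuffle_zero]; omega
      · rw [unshuffle_odd]; omega
      · rw [unshuffle_even]; omega
  rw [h1, prod_range_odd, Finset.prod_congr rfl h2, Finset.prod_pow_eq_pow_sum,
    Finset.sum_range_id]
  simp

end Shuffle

/-! ### Contraction with vectors isotropic up to `η ∧ b`. -/

section Contraction

variable {V : Type*} [AddCommGroup V] [Module ℝ V]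

theorem two_form_swap (τ : V [⋀^Fin 2]→ₗ[ℝ] ℝ) (u v : V) : τ ![u, v] = -τ ![v, u] := by
  have := τ.map_swap ![v, u] (i := 0) (j := 1) (by decide)
  rw [← this]
  congr 1
  ext i
  fin_cases i <;> simp

/-- The contraction of `η ∧ τⁿ` with `n + 1` vectors that are isotropic for `τ` up to a multiple
`b ∧ η`. -/
theorem contract_wedge_oneForm_wedgePow {n : ℕ} (η : V →ₗ[ℝ] ℝ) (τ : V [⋀^Fin 2]→ₗ[ℝ] ℝ)
    (b : V → ℝ) (X : Fin (n + 1) → V) (w : Fin n → V)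
    (hX : ∀ i j, τ ![X i, X j] = η (X i) * b (X j) - b (X i) * η (X j))
    (e : 1 + 2 * n = n + (n + 1)) :
    contract (k := n) (n + 1) ((wedge (oneForm η) (wedgePow τ n)).domDomCongr (finCongr e)) X w =
      (-1) ^ (n * (n - 1) / 2) * n ! * Matrix.det (Matrix.of fun i => Fin.cons (η (X i)) fun l =>
        τ ![X i, w l] - η (X i) * b (w l) + b (X i) * η (w l) :
        Matrix (Fin (n + 1)) (Fin (n + 1)) ℝ) := by
  set u : Fin (n + 1) ⊕ Fin n → V := Sum.elim X w with hu
  rw [contract_apply, AlternatingMap.domDomCongr_apply,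
    (isAlternatizationOf_wedge_oneForm_wedgePow η τ n).apply]
  have hvec : ∀ x, ((Fin.append X w ∘ Fin.cast (Nat.add_comm n (n + 1))) ∘ finCongr e)
      (blockEquiv n x) = u x := by
    rintro (i | i)
    · refine (congrArg (Fin.append X w) ?_).trans (Fin.append_left X w i)
      ext; simp [blockEquiv]
    · refine (congrArg (Fin.append X w) ?_).trans (Fin.append_right X w i)
      ext; simp [blockEquiv]
  have hmain := sum_sign_mul_prod_blocks (fun x => η (u x)) (fun x => b (u x))
    (fun x y => τ ![u x, u y]) (fun x y => two_form_swap τ _ _) hX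
  -- Arguments come in block order but slots are interleaved; reindexing both sides by `Fin (n + 1)
  -- ⊕ Fin n` costs the unshuffle sign. The `2 ^ n` in the denominator comes from alternatizing `τ /
  -- 2` and cancels against the one in `hmain`.
  have hsum : ∑ σ : Equiv.Perm (Fin (1 + 2 * n)), ((Equiv.Perm.sign σ : ℤ) : ℝ) *
      (fun v : Fin (1 + 2 * n) → V => η (v ⟨0, by omega⟩) *
        ∏ i : Fin n, τ ![v ⟨2 * i + 1, by omega⟩, v ⟨2 * i + 2, by omega⟩] / 2)
        (((Fin.append X w ∘ Fin.cast (Nat.add_comm n (n + 1))) ∘ finCongr e) ∘ σ) =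
      (-1) ^ (n * (n - 1) / 2) / 2 ^ n * ∑ ρ : Equiv.Perm (Fin (n + 1) ⊕ Fin n),
        ((Equiv.Perm.sign ρ : ℤ) : ℝ) * (η (u (ρ (Sum.inl 0))) *
          ∏ i : Fin n, τ ![u (ρ (Sum.inl i.succ)), u (ρ (Sum.inr i))]) := by
    rw [Finset.mul_sum]
    symm
    refine Fintype.sum_equiv (Equiv.equivCongr (slotEquiv n) (blockEquiv n)) _ _ fun ρ => ?_
    have hs : ((Equiv.Perm.sign (Equiv.equivCongr (slotEquiv n) (blockEquiv n) ρ) : ℤ) : ℝ) =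
        (-1) ^ (n * (n - 1) / 2) * ((Equiv.Perm.sign ρ : ℤ) : ℝ) := by
      have : Equiv.equivCongr (slotEquiv n) (blockEquiv n) ρ =
          (slotEquiv n).symm.trans (blockEquiv n) * (slotEquiv n).permCongr ρ := by
        ext k; simp [Equiv.permCongr_apply]
      rw [this, Equiv.Perm.sign_mul, Equiv.Perm.sign_permCongr, Units.val_mul, Int.cast_mul,
        sign_slotEquiv_symm_trans_blockEquiv]
    have hv : ∀ x, (((Fin.append X w ∘ Fin.cast (Nat.add_comm n (n + 1))) ∘ finCongr e) ∘
        Equiv.equivCongr (slotEquiv n) (blockEquiv n) ρ) (slotEquiv n x) = u (ρ x) := by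
      intro x
      rw [← hvec]
      simp
    have h0 := hv (Sum.inl 0)
    have hl := fun i : Fin n => hv (Sum.inl i.succ)
    have hr := fun i : Fin n => hv (Sum.inr i)
    have s0 : slotEquiv n (Sum.inl 0) = ⟨0, by omega⟩ := rfl
    have sl : ∀ i : Fin n, slotEquiv n (Sum.inl i.succ) = ⟨2 * i + 1, by omega⟩ := fun i => by
      ext; simp [slotEquiv]; omega
    have sr : ∀ i : Fin n, slotEquiv n (Sum.inr i) = ⟨2 * i + 2, by omega⟩ := fun i => rfl
    simp only [s0, sl, sr] at h0 hl hr
    simp only [h0, hl, hr, hs, Finset.prod_div_distrib, Finset.prod_const, Finset.card_univ,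
      Fintype.card_fin]
    ring
  rw [hsum, hmain]
  field_simp
  rfl

end Contraction

/-! ### Laplace expansion with rows in cyclic order. -/

section CyclicLaplace

/-- Translation by `j` is the `j`-th power of the `(n + 1)`-cycle, whose sign is `(-1) ^ n`. -/
theorem sign_addLeft (n : ℕ) (j : Fin (n + 1)) :
    Equiv.Perm.sign (Equiv.addLeft j) = (-1) ^ ((j : ℕ) * n) := by
  have h : ∀ k : ℕ, (Equiv.addLeft (Fin.ofNat (n + 1) k) : Equiv.Perm (Fin (n + 1))) =
      finRotate (n + 1) ^ k := by
    intro k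
    induction k with
    | zero => ext i; simp
    | succ k ih =>
      rw [pow_succ', ← ih]
      ext i
      simp only [Equiv.coe_addLeft, Equiv.Perm.coe_mul, Function.comp, finRotate_apply]
      congr 1
      ext
      simp [Fin.val_add, add_comm, add_left_comm, ← add_assoc]
  conv_lhs => rw [← Fin.ofNat_val_eq_self j]
  rw [h, map_pow, sign_finRotate, ← pow_mul, mul_comm]
  simp

/-- Rotating the rows by `j` moves the only nonzero entry of the first column to the corner. -/
theorem det_updateCol_zero_single {n : ℕ} (A : Matrix (Fin (n + 1)) (Fin (n + 1)) ℝ)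
    (j : Fin (n + 1)) :
    (A.updateCol 0 (Pi.single j 1)).det = (-1) ^ ((j : ℕ) * n) *
      Matrix.det (Matrix.of fun r l : Fin n => A (j + r.succ) l.succ) := by
  have h1 := Matrix.det_permute (Equiv.addLeft j) (A.updateCol 0 (Pi.single j 1))
  rw [sign_addLeft] at h1
  have h2 : (((A.updateCol 0 (Pi.single j 1)).submatrix (Equiv.addLeft j) id).det) =
      Matrix.det (Matrix.of fun r l : Fin n => A (j + r.succ) l.succ) := by
    rw [Matrix.det_succ_column_zero, Fin.sum_univ_succ, Finset.sum_eq_zero]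
    · simp
      congr 1
    · intro i _
      simp
  have h3 : ((-1 : ℝ) ^ ((j : ℕ) * n)) * (-1) ^ ((j : ℕ) * n) = 1 := by
    rw [← mul_pow]; simp
  rw [← h2, h1]
  push_cast
  rw [← mul_assoc, h3, one_mul]

/-- Laplace expansion along the first column, with the remaining rows in cyclic order. -/
theorem det_eq_sum_cyclic {n : ℕ} (A : Matrix (Fin (n + 1)) (Fin (n + 1)) ℝ) :
    A.det = ∑ j : Fin (n + 1), (-1) ^ ((j : ℕ) * n) * A j 0 *
      Matrix.det (Matrix.of fun r l : Fin n => A (j + r.succ) l.succ) := by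
  have hsum : ∀ u : Fin (n + 1) → ℝ,
      (A.updateCol 0 u).det = ∑ j, u j * (A.updateCol 0 (Pi.single j 1)).det := by
    intro u
    let D : (Fin (n + 1) → ℝ) →ₗ[ℝ] ℝ :=
      { toFun := fun u => (A.updateCol 0 u).det
        map_add' := Matrix.det_updateCol_add A 0
        map_smul' := Matrix.det_updateCol_smul A 0 }
    have hs : ∀ j : Fin (n + 1), (fun i => if j = i then (1 : ℝ) else 0) = Pi.single j 1 := by
      intro j
      funext i
      simp [Pi.single_apply, eq_comm]
    have := D.pi_apply_eq_sum_univ u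
    simp only [hs] at this
    exact this
  have h : A = A.updateCol 0 (fun j => A j 0) := (Matrix.updateCol_eq_self A 0).symm
  conv_lhs => rw [h]
  rw [hsum]
  refine Finset.sum_congr rfl fun j _ => ?_
  rw [det_updateCol_zero_single]
  ring

theorem det_cons_sub_mul {n : ℕ} (f : Fin (n + 1) → ℝ) (a : Fin (n + 1) → Fin n → ℝ)
    (c : Fin n → ℝ) :
    Matrix.det (Matrix.of fun i => Fin.cons (f i) fun l => a i l - f i * c l :
      Matrix (Fin (n + 1)) (Fin (n + 1)) ℝ) =
    Matrix.det (Matrix.of fun i => Fin.cons (f i) (a i) :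
      Matrix (Fin (n + 1)) (Fin (n + 1)) ℝ) := by
  rw [← Matrix.det_transpose, ← Matrix.det_transpose (Matrix.of fun i => Fin.cons (f i) (a i))]
  -- After transposing, row 0 is added to the others with coefficients `-c l`, and to itself with
  -- coefficient 0.
  refine Matrix.det_eq_of_forall_row_eq_smul_add_const (Fin.cons 0 fun l => -c l) 0 rfl ?_
  intro l i
  refine Fin.cases ?_ (fun l => ?_) l
  · simp
  · simp
    ring

end CyclicLaplace

/-! ### Linear algebra of a contact form at one point. -/

section ContactLinearAlgebra

variable {V : Type*} [AddCommGroup V] [Module ℝ V]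

theorem wedge_oneForm_wedgePow_apply_eq_zero {n : ℕ} {η : V →ₗ[ℝ] ℝ} {τ : V [⋀^Fin 2]→ₗ[ℝ] ℝ}
    {v : Fin (1 + 2 * n) → V} {k : Fin (1 + 2 * n)} (hη : η (v k) = 0)
    (hτ : ∀ w, τ ![v k, w] = 0) : wedge (oneForm η) (wedgePow τ n) v = 0 := by
  rw [(isAlternatizationOf_wedge_oneForm_wedgePow η τ n).apply]
  refine Finset.sum_eq_zero fun σ _ => mul_eq_zero_of_right _ ?_
  obtain ⟨j, rfl⟩ := σ.surjective k
  obtain h | ⟨i, h⟩ | ⟨i, h⟩ : (j : ℕ) = 0 ∨ (∃ i : Fin n, (j : ℕ) = 2 * i + 1) ∨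
      ∃ i : Fin n, (j : ℕ) = 2 * i + 2 := by
    rcases Nat.even_or_odd' j with ⟨m, h | h⟩
    · rcases m with _ | m
      · exact Or.inl h
      · exact Or.inr (Or.inr ⟨⟨m, by omega⟩, h⟩)
    · exact Or.inr (Or.inl ⟨⟨m, by omega⟩, h⟩)
  · have hj : j = ⟨0, by omega⟩ := Fin.ext h
    rw [hj] at hη hτ
    exact mul_eq_zero_of_left hη _
  · have hj : j = ⟨2 * i + 1, by omega⟩ := Fin.ext h
    rw [hj] at hη hτ
    refine mul_eq_zero_of_right _ (Finset.prod_eq_zero (Finset.mem_univ i) ?_)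
    simp only [Function.comp, hτ, zero_div]
  · have hj : j = ⟨2 * i + 2, by omega⟩ := Fin.ext h
    rw [hj] at hη hτ
    refine mul_eq_zero_of_right _ (Finset.prod_eq_zero (Finset.mem_univ i) ?_)
    rw [two_form_swap]
    simp only [Function.comp, hτ, neg_zero, zero_div]

/-- The top form is nonzero on a basis. Replacing the `k`-th basis vector by `v` gives zero, but
also multiplies the value by the `k`-th coordinate of `v`. -/
theorem eq_zero_of_wedge_oneForm_wedgePow_ne_zero {n : ℕ} [FiniteDimensional ℝ V]
    (hV : Module.finrank ℝ V = 2 * n + 1) {η : V →ₗ[ℝ] ℝ} {τ : V [⋀^Fin 2]→ₗ[ℝ] ℝ}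
    (hΩ : wedge (oneForm η) (wedgePow τ n) ≠ 0) {v : V} (hη : η v = 0)
    (hτ : ∀ w, τ ![v, w] = 0) : v = 0 := by
  let B : Module.Basis (Fin (1 + 2 * n)) ℝ V := Module.finBasisOfFinrankEq ℝ V (by omega)
  have hB : wedge (oneForm η) (wedgePow τ n) B ≠ 0 := fun h => hΩ <|
    Module.Basis.ext_alternating B fun w hw => by
      obtain ⟨σ, rfl⟩ : ∃ σ : Equiv.Perm (Fin (1 + 2 * n)), ⇑σ = w :=
        ⟨Equiv.ofBijective w (Finite.injective_iff_bijective.1 hw), rfl⟩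
      have := AlternatingMap.map_perm (wedge (oneForm η) (wedgePow τ n)) B σ
      rw [h, smul_zero] at this
      exact this
  refine B.ext_elem fun k => ?_
  rw [map_zero, Finsupp.zero_apply]
  have h0 : wedge (oneForm η) (wedgePow τ n) (Function.update B k v) = 0 :=
    wedge_oneForm_wedgePow_apply_eq_zero (k := k) (by simpa using hη) (by simpa using hτ)
  have h1 : wedge (oneForm η) (wedgePow τ n) (Function.update B k v) =
      B.repr v k * wedge (oneForm η) (wedgePow τ n) B := by
    conv_lhs => rw [← B.sum_repr v]
    rw [AlternatingMap.map_update_sum, Finset.sum_eq_single k]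
    · rw [AlternatingMap.map_update_smul, Function.update_eq_self, smul_eq_mul]
    · intro j _ hj
      rw [AlternatingMap.map_update_smul, AlternatingMap.map_update_self _ _ hj.symm, smul_zero]
    · simp
  exact (mul_eq_zero.1 (h1.symm.trans h0)).resolve_right hB

/-- A `2`-form regarded as a bilinear form. -/
def bilin (τ : V [⋀^Fin 2]→ₗ[ℝ] ℝ) : V →ₗ[ℝ] V →ₗ[ℝ] ℝ :=
  LinearMap.mk₂ ℝ (fun v w => τ ![v, w])
    (fun u v w => τ.map_vecCons_add ![w] u v) (fun c v w => τ.map_vecCons_smul ![w] c v)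
    (fun w u v => by
      rw [two_form_swap, two_form_swap τ w u, two_form_swap τ w v, ← neg_add]
      exact congrArg _ (τ.map_vecCons_add ![w] u v))
    (fun c w v => by
      rw [two_form_swap, two_form_swap τ w v, smul_neg]
      exact congrArg _ (τ.map_vecCons_smul ![w] c v))

theorem bilin_apply (τ : V [⋀^Fin 2]→ₗ[ℝ] ℝ) (v w : V) : bilin τ v w = τ ![v, w] := rfl

/-- A skew-symmetric matrix of odd size is singular. -/
theorem exists_ne_zero_two_form_eq_zero {n : ℕ} [FiniteDimensional ℝ V]
    (hV : Module.finrank ℝ V = 2 * n + 1) (τ : V [⋀^Fin 2]→ₗ[ℝ] ℝ) :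
    ∃ v : V, v ≠ 0 ∧ ∀ w, τ ![v, w] = 0 := by
  let B : Module.Basis (Fin (2 * n + 1)) ℝ V := Module.finBasisOfFinrankEq ℝ V hV
  let A : Matrix (Fin (2 * n + 1)) (Fin (2 * n + 1)) ℝ := Matrix.of fun i j => τ ![B i, B j]
  have hA : A.det = 0 := by
    have h1 : A.transpose = -A := by
      ext i j
      exact two_form_swap τ _ _
    have h2 := congrArg Matrix.det h1
    rw [Matrix.det_transpose, Matrix.det_neg, Fintype.card_fin,
      Odd.neg_one_pow (by simp)] at h2
    linarith
  obtain ⟨c, hc, hcA⟩ := Matrix.exists_vecMul_eq_zero_iff.2 hA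
  refine ⟨∑ i, c i • B i, fun h => hc ?_, fun w => ?_⟩
  · ext i
    have := congrArg (fun v => B.repr v i) h
    simpa [Finsupp.single_apply] using this
  · suffices h : bilin τ (∑ i, c i • B i) = 0 from LinearMap.congr_fun h w
    refine B.ext fun j => ?_
    have := congrFun hcA j
    simpa [Matrix.vecMul, dotProduct, A, bilin_apply] using this

/-- Surjectivity of `♭`, from injectivity and equality of dimensions: evaluating `♭ v = 0` at `v`
gives `η v ^ 2 = 0`. -/
theorem exists_two_form_add_eq {n : ℕ} [FiniteDimensional ℝ V]
    (hV : Module.finrank ℝ V = 2 * n + 1) {η : V →ₗ[ℝ] ℝ} {τ : V [⋀^Fin 2]→ₗ[ℝ] ℝ}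
    (hΩ : wedge (oneForm η) (wedgePow τ n) ≠ 0) (σ : V →ₗ[ℝ] ℝ) :
    ∃ v, ∀ w, τ ![v, w] + η v * η w = σ w := by
  let F : V →ₗ[ℝ] Module.Dual ℝ V := bilin τ + LinearMap.smulRight η η
  have hF : ∀ v w, F v w = τ ![v, w] + η v * η w := fun v w => rfl
  have hinj : Function.Injective F := by
    rw [injective_iff_map_eq_zero]
    intro v hv
    have h : ∀ w, τ ![v, w] + η v * η w = 0 := fun w => by rw [← hF, hv]; rfl
    have hvv : τ ![v, v] = 0 := by linarith [two_form_swap τ v v]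
    have hη : η v = 0 := by simpa [hvv] using h v
    exact eq_zero_of_wedge_oneForm_wedgePow_ne_zero hV hΩ hη fun w => by simpa [hη] using h w
  obtain ⟨v, hv⟩ := (LinearMap.injective_iff_surjective_of_finrank_eq_finrank
    Subspace.dual_finrank_eq.symm).1 hinj σ
  exact ⟨v, fun w => by rw [← hF, hv]⟩

theorem exists_reeb {n : ℕ} [FiniteDimensional ℝ V]
    (hV : Module.finrank ℝ V = 2 * n + 1) {η : V →ₗ[ℝ] ℝ} {τ : V [⋀^Fin 2]→ₗ[ℝ] ℝ}
    (hΩ : wedge (oneForm η) (wedgePow τ n) ≠ 0) :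
    ∃ v, η v = 1 ∧ ∀ w, τ ![v, w] = 0 := by
  obtain ⟨v, hv, hτ⟩ := exists_ne_zero_two_form_eq_zero hV τ
  have hη : η v ≠ 0 := fun h => hv (eq_zero_of_wedge_oneForm_wedgePow_ne_zero hV hΩ h hτ)
  refine ⟨(η v)⁻¹ • v, by simp [hη], fun w => ?_⟩
  rw [← bilin_apply, map_smul, LinearMap.smul_apply, bilin_apply, hτ, smul_zero]

/-- The minus sign absorbs the one in `η (X i) = -f i`. -/
theorem neg_one_pow_half_mul_half (n : ℕ) :
    (-1 : ℝ) ^ ((n + 1) * (n + 2) / 2) = -(-1) ^ (n * (n - 1) / 2) := by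
  have h : (n + 1) * (n + 2) / 2 = n * (n - 1) / 2 + 2 * n + 1 := by
    rcases n with _ | n
    · rfl
    · have : (n + 1 + 1) * (n + 1 + 2) = (n + 1) * n + 2 * (2 * (n + 1) + 1) := by ring
      rw [this, Nat.add_mul_div_left _ _ two_pos]
      rfl
  rw [h, pow_succ, pow_add, pow_mul (-1 : ℝ) 2]
  simp

theorem alternatingMap_sum_apply {ι κ : Type*} [Fintype κ] (A : κ → V [⋀^ι]→ₗ[ℝ] ℝ)
    (v : ι → V) : (∑ j, A j) v = ∑ j, A j v :=
  map_sum (⟨⟨fun B : V [⋀^ι]→ₗ[ℝ] ℝ => B v, rfl⟩, fun _ _ => rfl⟩ : (V [⋀^ι]→ₗ[ℝ] ℝ) →+ ℝ) A _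

/-- The contraction of `η ∧ τⁿ` with `n + 1` vectors in involution. -/
theorem contract_eq_of_involution {n : ℕ} {η : V →ₗ[ℝ] ℝ} {τ : V [⋀^Fin 2]→ₗ[ℝ] ℝ}
    {X : Fin (n + 1) → V} {f r : Fin (n + 1) → ℝ} {α : Fin (n + 1) → V →ₗ[ℝ] ℝ}
    (hη : ∀ i, η (X i) = -f i) (hτ : ∀ i w, τ ![X i, w] = α i w - r i * η w)
    (hX : ∀ i j, τ ![X i, X j] = f j * r i - f i * r j) (e : 1 + 2 * n = n + (n + 1)) :
    contract (k := n) (n + 1) ((wedge (oneForm η) (wedgePow τ n)).domDomCongr (finCongr e)) X =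
      ((n ! : ℝ) * (-1 : ℝ) ^ ((n + 1) * (n + 2) / 2)) •
        ∑ j : Fin (n + 1), ((-1 : ℝ) ^ ((j : ℕ) * n) * f j) •
          wedgeProd n (fun i : Fin n => α (j + i.succ)) := by
  ext w
  rw [AlternatingMap.smul_apply, alternatingMap_sum_apply]
  simp only [AlternatingMap.smul_apply, wedgeProd_apply_eq_det, smul_eq_mul]
  by_cases hf : ∀ k, f k = 0
  · rw [contract_wedge_oneForm_wedgePow η τ 0 X w (fun i j => by simp [hX, hf]),
      Matrix.det_eq_zero_of_column_eq_zero 0 (fun i => by simp [hη, hf])]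
    simp [hf]
  · push Not at hf
    obtain ⟨k, hk⟩ := hf
    -- This makes `b = -α k / f k` take the value `r j` at `X j`, as the isotropy condition
    -- requires.
    have hb : ∀ j, α k (X j) = -(f k * r j) := fun j => by
      have h1 := hτ k (X j)
      rw [hX, hη] at h1
      linarith
    rw [contract_wedge_oneForm_wedgePow η τ (fun v => -(α k v / f k)) X w]
    -- The `r i * η (w l)` terms cancel; what is left beside `α i (w l)` is a multiple of the first
    -- column.
    · have hM : (Matrix.of fun i => Fin.cons (η (X i)) fun l =>
          τ ![X i, w l] - η (X i) * -(α k (w l) / f k) + -(α k (X i) / f k) * η (w l) :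
          Matrix (Fin (n + 1)) (Fin (n + 1)) ℝ) = Matrix.of fun i => Fin.cons (-f i) fun l =>
          α i (w l) - -f i * -(α k (w l) / f k) := by
        congr 1
        funext i
        rw [hη, hb]
        congr 1
        funext l
        rw [hτ]
        field_simp
        ring
      rw [hM, det_cons_sub_mul (fun i => -f i) (fun i l => α i (w l)), det_eq_sum_cyclic,
        neg_one_pow_half_mul_half, Finset.mul_sum, Finset.mul_sum]
      refine Finset.sum_congr rfl fun j _ => ?_
      simp only [Matrix.of_apply, Fin.cons_zero, Fin.cons_succ]
      ring
    · intro i j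
      rw [hX, hη, hη, hb, hb]
      field_simp
      ring

end ContactLinearAlgebra

/-! ### Reeb field, Hamiltonian fields and Jacobi bracket at a point. -/

section Pointwise

variable {n : ℕ} {M : Type*} [TopologicalSpace M]
  [ChartedSpace (EuclideanSpace ℝ (Fin (2 * n + 1))) M] {η : OneForm (2 * n + 1) M} {x : M}

instance : FiniteDimensional ℝ (TangentSpace (𝓡 (2 * n + 1)) x) :=
  inferInstanceAs (FiniteDimensional ℝ (EuclideanSpace ℝ (Fin (2 * n + 1))))

theorem finrank_tangentSpace :
    Module.finrank ℝ (TangentSpace (𝓡 (2 * n + 1)) x) = 2 * n + 1 :=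
  finrank_euclideanSpace_fin (𝕜 := ℝ) (n := 2 * n + 1)

theorem flat_apply (v w : TangentSpace (𝓡 (2 * n + 1)) x) :
    flat η x v w = extD η x ![v, w] + η x v * η x w := by
  simp only [flat, LinearMap.add_apply, LinearMap.smul_apply, smul_eq_mul]
  congr 1
  refine (AlternatingMap.curryLeft_apply_apply (n := 1) (extD η x) v _).trans ?_
  congr 1
  ext i
  fin_cases i <;> rfl

theorem reeb_spec (hΩ : vol n η x ≠ 0) :
    η x (reeb η x) = 1 ∧ ∀ w, extD η x ![reeb η x, w] = 0 :=
  Classical.epsilon_spec (p := fun v : TangentSpace (𝓡 (2 * n + 1)) x =>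
    η x v = 1 ∧ ∀ w, extD η x ![v, w] = 0) (exists_reeb finrank_tangentSpace hΩ)

theorem flat_sharp (hΩ : vol n η x ≠ 0) (σ : TangentSpace (𝓡 (2 * n + 1)) x →ₗ[ℝ] ℝ) :
    flat η x (sharp η x σ) = σ := by
  refine Function.invFun_eq (f := flat η x) ?_
  obtain ⟨v, hv⟩ := exists_two_form_add_eq finrank_tangentSpace hΩ σ
  exact ⟨v, LinearMap.ext fun w => (flat_apply v w).trans (hv w)⟩

/-- Evaluating `♭ (♭⁻¹ σ) = σ` at the Reeb vector isolates `η (♭⁻¹ σ)`. -/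
theorem sharp_spec (hΩ : vol n η x ≠ 0) (σ : TangentSpace (𝓡 (2 * n + 1)) x →ₗ[ℝ] ℝ) :
    η x (sharp η x σ) = σ (reeb η x) ∧
      ∀ w, extD η x ![sharp η x σ, w] = σ w - σ (reeb η x) * η x w := by
  obtain ⟨hR, hRτ⟩ := reeb_spec hΩ
  have h : ∀ w, extD η x ![sharp η x σ, w] + η x (sharp η x σ) * η x w = σ w := fun w => by
    rw [← flat_apply, flat_sharp hΩ]
  have h1 : η x (sharp η x σ) = σ (reeb η x) := by
    have := h (reeb η x)
    rw [two_form_swap, hRτ, hR] at this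
    linarith
  exact ⟨h1, fun w => by rw [← h1]; linarith [h w]⟩

theorem hamVF_spec (hΩ : vol n η x ≠ 0) (f : M → ℝ) :
    η x (hamVF η f x) = -f x ∧
      ∀ w, extD η x ![hamVF η f x, w] = df f x w - df f x (reeb η x) * η x w := by
  refine Classical.epsilon_spec (p := fun v : TangentSpace (𝓡 (2 * n + 1)) x => η x v = -f x ∧
    ∀ w, extD η x ![v, w] = df f x w - df f x (reeb η x) * η x w) ?_
  obtain ⟨hR, hRτ⟩ := reeb_spec hΩ
  -- `X_f = ♭⁻¹ (df - (R(f) + f) η)`: the coefficient of `η` is chosen so that the covector takes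
  -- the value `-f` on the Reeb vector.
  obtain ⟨h1, h2⟩ := sharp_spec hΩ
    ((df f x).toLinearMap - (df f x (reeb η x) + f x) • (η x).toLinearMap)
  refine ⟨_, h1.trans ?_, fun w => (h2 w).trans ?_⟩
  · simp [hR]
  · simp [hR]
    ring

/-- `♭⁻¹ df` and `X_f` have the same contraction with `dη`, since subtracting a multiple of `η` from
`df` changes `♭⁻¹ df` only along the Reeb direction. -/
theorem bivector_df (hΩ : vol n η x ≠ 0) (f g : M → ℝ) :
    bivector η x (df f x).toLinearMap (df g x).toLinearMap =
      -extD η x ![hamVF η f x, hamVF η g x] := by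
  have h : ∀ f w, extD η x ![sharp η x (df f x).toLinearMap, w] = extD η x ![hamVF η f x, w] :=
    fun f w => ((sharp_spec hΩ _).2 w).trans ((hamVF_spec hΩ f).2 w).symm
  have h' : bivector η x (df f x).toLinearMap (df g x).toLinearMap =
      -extD η x ![sharp η x (df f x).toLinearMap, sharp η x (df g x).toLinearMap] := rfl
  rw [h', h, two_form_swap, h, two_form_swap (extD η x) (hamVF η f x)]

theorem extD_hamVF_hamVF (hΩ : vol n η x ≠ 0) {f g : M → ℝ} (hfg : jacobiBracket η f g x = 0) :
    extD η x ![hamVF η f x, hamVF η g x] =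
      g x * df f x (reeb η x) - f x * df g x (reeb η x) := by
  rw [jacobiBracket, bivector_df hΩ, map_neg, map_neg] at hfg
  linarith

end Pointwise

end ContactGeom

end

theorem mainTheorem9 (n : ℕ) {M : Type*} [TopologicalSpace M]
    [ChartedSpace (EuclideanSpace ℝ (Fin (2 * n + 1))) M] [IsManifold (𝓡 (2 * n + 1)) ∞ M]
    (η : ContactGeom.OneForm (2 * n + 1) M) (f : Fin (n + 1) → M → ℝ)
    (h : ContactGeom.IsCompleteContactIntegrable η f) (x : M) :
    ContactGeom.contract (k := n) (n + 1)
        ((ContactGeom.vol n η x).domDomCongr (finCongr (by omega : 1 + 2 * n = n + (n + 1))))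
        (fun i : Fin (n + 1) => ContactGeom.hamVF η (f i) x) =
      ((n ! : ℝ) * (-1 : ℝ) ^ ((n + 1) * (n + 2) / 2)) •
        ∑ j : Fin (n + 1), ((-1 : ℝ) ^ ((j : ℕ) * n) * f j x) •
          ContactGeom.wedgeProd n
            (fun r : Fin n => (ContactGeom.df (f (j + r.succ)) x).toLinearMap) :=
  have hΩ := h.contact.nondegenerate x
  ContactGeom.contract_eq_of_involution
    (r := fun i => ContactGeom.df (f i) x (ContactGeom.reeb η x))
    (fun i => (ContactGeom.hamVF_spec hΩ (f i)).1)
    (fun i w => (ContactGeom.hamVF_spec hΩ (f i)).2 w)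
    (fun i j => ContactGeom.extD_hamVF_hamVF hΩ (h.involution i j x)) _
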